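/- Let $\Phi$ be a real nuclear space: a Hausdorff locally convex space whose topology is generated by a family $P$ of Hilbertian seminorms (seminorms with $p(\phi)^2=Q(\phi,\phi)$ for a symmetric non-negative bilinear form $Q$) such that for each $p\in P$ there is $q\in P$ with $p\le q$ for which the canonical map $\Phi_q\to\Phi_p$ is Hilbert–Schmidt. Here $\Phi_p$ is the Hilbert space obtained by completing $\Phi/\ker p$, and $\Phi'_p$ is its dual with the dual norm. Let $\Phi'_\beta$ be the strong dual of $\Phi$ and let $T>0$. For a locally convex space $E$, let $D_T(E)$ be the space of càdlàg maps $[0,T]\to E$ with the Skorokhod ($J_1$) topology, generated by the pseudometrics $$d_r(x,y)=\inf_{\lambda}\Big\{\sup_{t\in[0,T]} r\big(x(t)-y(\lambda(t))\big)+\sup_{0\le s<t\le T}\Big|\log\tfrac{\lambda(t)-\lambda(s)}{t-s}\Big|\Big\},$$ where $r$ runs over the continuous seminorms on $E$ and $\lambda$ over the strictly increasing continuous maps of $[0,T]$ onto itself. For $\phi\in\Phi$ let $\Pi_\phi:D_T(\Phi'_\beta)\to D_T(\mathbb R)$, $x\mapsto (x(t)[\phi])_{t\in[0,T]}$. For a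 continuous Hilbertian seminorm $q$ on $\Phi$, regard $D_T(\Phi'_q)$ as a subset of $D_T(\Phi'_\beta)$ through the canonical inclusion $\Phi'_q\to\Phi'_\beta$. Let $A\subseteq D_T(\Phi'_\beta)$ and consider the statements: 1. $A$ is compact in $D_T(\Phi'_\beta)$. 2. For every $\phi\in\Phi$, the set $\Pi_\phi(A)$ is compact in $D_T(\mathbb R)$. 3. There is a continuous Hilbertian seminorm $q$ on $\Phi$ such that $A$ is contained in $D_T(\Phi'_q)$ and compact there. Then (1) $\Rightarrow$ (2) and (3) $\Rightarrow$ (1). If moreover $\Phi$ is barrelled (every lower semicontinuous seminorm on $\Phi$ is continuous) and $A$ is closed in $D_T(\Phi'_\beta)$, then (2) $\Rightarrow$ (3). For an arbitrary set $A\subseteq D_T(\Phi'_\beta)$, the implications (1) $\Rightarrow$ (2) and (3) $\Rightarrow$ (1), and, if $\Phi$ is barrelled, (2) $\Rightarrow$ (3), also hold when "compact" is replaced by "relatively compact" (having compact closure in the space in question) in all three statements. -/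

import Mathlib

open Set Filter Topology
open scoped ENNReal

namespace SkorokhodDual

noncomputable section

/-! ### The Skorokhod space of càdlàg maps on a compact interval -/

/-- Càdlàg maps `[0,T] → E`: right-continuous at every point, with a left limit at every point
(at `0` the punctured left neighbourhood filter is trivial, so nothing is asked there). -/
structure CadlagMap (T : ℝ) (E : Type*) [TopologicalSpace E] where
  toFun : Icc (0 : ℝ) T → E
  rightContinuous : ∀ t, ContinuousWithinAt toFun (Ioi t) t
  leftLimits : ∀ t, ∃ l, Tendsto toFun (𝓝[<] t) (𝓝 l)

instance CadlagMap.instCoeFun {T : ℝ} {E : Type*} [TopologicalSpace E] :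
    CoeFun (CadlagMap T E) (fun _ => Icc (0 : ℝ) T → E) where
  coe := CadlagMap.toFun

/-- Composition of a càdlàg map with a continuous map. -/
def CadlagMap.map {T : ℝ} {E F : Type*} [TopologicalSpace E] [TopologicalSpace F]
    (f : E → F) (hf : Continuous f) (x : CadlagMap T E) : CadlagMap T F where
  toFun := fun t => f (x t)
  rightContinuous := fun t => hf.continuousAt.comp_continuousWithinAt (x.rightContinuous t)
  leftLimits := fun t => by
    obtain ⟨l, hl⟩ := x.leftLimits t
    exact ⟨f l, (hf.tendsto l).comp hl⟩

/-- Time changes of `[0,T]`. The order isomorphisms of `[0,T]` are precisely the strictly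
increasing continuous maps of `[0,T]` onto itself. -/
abbrev TimeChange (T : ℝ) : Type := Icc (0 : ℝ) T ≃o Icc (0 : ℝ) T

/-- `sup_{s < t} |log ((μ t - μ s) / (t - s))|`, possibly `∞`. -/
def timeChangeCost {T : ℝ} (μ : TimeChange T) : ℝ≥0∞ :=
  ⨆ (s : Icc (0 : ℝ) T) (t : Icc (0 : ℝ) T) (_ : s < t),
    ENNReal.ofReal |Real.log (((μ t : ℝ) - (μ s : ℝ)) / ((t : ℝ) - (s : ℝ)))|

/-- The Skorokhod pseudo-distance attached to a seminorm `p`: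
the infimum over time changes `μ` of `sup_t p (x t - y (μ t))` plus the cost of `μ`. -/
def skorokhodEDist {T : ℝ} {E : Type*} [AddCommGroup E] [Module ℝ E] (p : Seminorm ℝ E)
    (x y : Icc (0 : ℝ) T → E) : ℝ≥0∞ :=
  ⨅ μ : TimeChange T, (⨆ t, ENNReal.ofReal (p (x t - y (μ t)))) + timeChangeCost μ

theorem timeChangeCost_refl {T : ℝ} : timeChangeCost (OrderIso.refl (Icc (0 : ℝ) T)) = 0 := by
  simp only [timeChangeCost, ENNReal.iSup_eq_zero]
  intro s t hst
  have h : (t : ℝ) - (s : ℝ) ≠ 0 := sub_ne_zero.mpr (ne_of_gt (show (s : ℝ) < t from hst))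
  simp [div_self h]

theorem timeChangeCost_symm_le {T : ℝ} (μ : TimeChange T) :
    timeChangeCost μ.symm ≤ timeChangeCost μ := by
  refine iSup_le fun s => iSup_le fun t => iSup_le fun hst => ?_
  have h : μ.symm s < μ.symm t := μ.symm.lt_iff_lt.mpr hst
  refine le_trans (le_of_eq ?_)
    (le_iSup_of_le (μ.symm s) (le_iSup_of_le (μ.symm t) (le_iSup_of_le h le_rfl)))
  rw [μ.apply_symm_apply, μ.apply_symm_apply, ← abs_neg, ← Real.log_inv, inv_div]

theorem timeChangeCost_trans_le {T : ℝ} (μ ν : TimeChange T) :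
    timeChangeCost (μ.trans ν) ≤ timeChangeCost μ + timeChangeCost ν := by
  refine iSup_le fun s => iSup_le fun t => iSup_le fun hst => ?_
  have h : μ s < μ t := μ.lt_iff_lt.mpr hst
  have h' : ν (μ s) < ν (μ t) := ν.lt_iff_lt.mpr h
  have a1 : (t : ℝ) - (s : ℝ) ≠ 0 := sub_ne_zero.mpr (ne_of_gt (show (s : ℝ) < t from hst))
  have a2 : (μ t : ℝ) - (μ s : ℝ) ≠ 0 := sub_ne_zero.mpr (ne_of_gt (show (μ s : ℝ) < μ t from h))
  have a3 : (ν (μ t) : ℝ) - (ν (μ s) : ℝ) ≠ 0 :=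
    sub_ne_zero.mpr (ne_of_gt (show (ν (μ s) : ℝ) < ν (μ t) from h'))
  have b1 : ENNReal.ofReal |Real.log (((μ t : ℝ) - (μ s : ℝ)) / ((t : ℝ) - (s : ℝ)))|
      ≤ timeChangeCost μ :=
    le_iSup_of_le s (le_iSup_of_le t (le_iSup_of_le hst le_rfl))
  have b2 : ENNReal.ofReal
      |Real.log (((ν (μ t) : ℝ) - (ν (μ s) : ℝ)) / ((μ t : ℝ) - (μ s : ℝ)))|
      ≤ timeChangeCost ν :=
    le_iSup_of_le (μ s) (le_iSup_of_le (μ t) (le_iSup_of_le h le_rfl))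
  refine le_trans ?_ (add_le_add b1 b2)
  rw [← ENNReal.ofReal_add (abs_nonneg _) (abs_nonneg _)]
  refine ENNReal.ofReal_le_ofReal ?_
  have e : ((ν (μ t) : ℝ) - (ν (μ s) : ℝ)) / ((t : ℝ) - (s : ℝ))
      = (((μ t : ℝ) - (μ s : ℝ)) / ((t : ℝ) - (s : ℝ)))
        * (((ν (μ t) : ℝ) - (ν (μ s) : ℝ)) / ((μ t : ℝ) - (μ s : ℝ))) := by
    field_simp
  simp only [OrderIso.trans_apply]
  rw [e, Real.log_mul (div_ne_zero a2 a1) (div_ne_zero a3 a2)]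
  exact abs_add_le _ _

section PseudoMetric

variable {T : ℝ} {E : Type*} [AddCommGroup E] [Module ℝ E] (p : Seminorm ℝ E)

theorem skorokhodEDist_self (x : Icc (0 : ℝ) T → E) : skorokhodEDist p x x = 0 := by
  refine le_antisymm (iInf_le_of_le (OrderIso.refl _) ?_) bot_le
  rw [timeChangeCost_refl]
  simp

theorem skorokhodEDist_comm_le (x y : Icc (0 : ℝ) T → E) :
    skorokhodEDist p x y ≤ skorokhodEDist p y x := by
  refine le_iInf fun μ => iInf_le_of_le μ.symm ?_
  refine add_le_add (iSup_le fun t => le_iSup_of_le (μ.symm t) ?_) (timeChangeCost_symm_le μ)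
  rw [μ.apply_symm_apply, map_sub_rev]

theorem skorokhodEDist_triangle (x y z : Icc (0 : ℝ) T → E) :
    skorokhodEDist p x z ≤ skorokhodEDist p x y + skorokhodEDist p y z := by
  refine ENNReal.le_iInf_add_iInf fun μ ν => ?_
  refine iInf_le_of_le (μ.trans ν) ?_
  rw [add_add_add_comm]
  refine add_le_add (iSup_le fun t => ?_) (timeChangeCost_trans_le μ ν)
  refine le_trans ?_ (add_le_add (le_iSup (fun t => ENNReal.ofReal (p (x t - y (μ t)))) t)
    (le_iSup (fun t => ENNReal.ofReal (p (y t - z (ν t)))) (μ t)))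
  rw [← ENNReal.ofReal_add (apply_nonneg _ _) (apply_nonneg _ _)]
  refine ENNReal.ofReal_le_ofReal ?_
  have h := map_add_le_add p (x t - y (μ t)) (y (μ t) - z (ν (μ t)))
  rwa [sub_add_sub_cancel] at h

end PseudoMetric

/-- The pseudo-metric structure on the space of càdlàg maps given by a seminorm. -/
abbrev skorokhodPseudoEMetric (T : ℝ) {E : Type*} [AddCommGroup E] [Module ℝ E]
    [TopologicalSpace E] (p : Seminorm ℝ E) : PseudoEMetricSpace (CadlagMap T E) where
  edist x y := skorokhodEDist p x y
  edist_self x := skorokhodEDist_self p x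
  edist_comm x y := le_antisymm (skorokhodEDist_comm_le p x y) (skorokhodEDist_comm_le p y x)
  edist_triangle x y z := skorokhodEDist_triangle p x y z

/-- The Skorokhod (J1) uniformity on the space of càdlàg maps with values in a locally convex
space `E`: it is generated by the pseudo-metrics attached to all continuous seminorms on `E`. -/
instance CadlagMap.instUniformSpace (T : ℝ) (E : Type*) [AddCommGroup E] [Module ℝ E]
    [TopologicalSpace E] : UniformSpace (CadlagMap T E) :=
  ⨅ p : {p : Seminorm ℝ E // Continuous p}, (skorokhodPseudoEMetric T p.1).toUniformSpace

/-! ### Hilbertian seminorms and nuclear spaces -/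

/-- A continuous Hilbertian seminorm: `p φ ^ 2 = Q φ φ` with `Q` a symmetric bilinear form, which
is then non-negative. (`Q` is determined by `p` through polarization.) -/
structure HilbertSeminorm (Φ : Type*) [AddCommGroup Φ] [Module ℝ Φ] [TopologicalSpace Φ] where
  toSeminorm : Seminorm ℝ Φ
  form : Φ →ₗ[ℝ] Φ →ₗ[ℝ] ℝ
  form_symm : ∀ φ ψ, form φ ψ = form ψ φ
  sq_eq_form : ∀ φ, toSeminorm φ ^ 2 = form φ φ
  continuous_toSeminorm : Continuous toSeminorm

namespace HilbertSeminorm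

variable {Φ : Type*} [AddCommGroup Φ] [Module ℝ Φ] [TopologicalSpace Φ]

/-- The vector space `Φ` with the seminorm `p` as its (semi)norm. -/
def Pre (_p : HilbertSeminorm Φ) : Type _ := Φ

instance (p : HilbertSeminorm Φ) : SeminormedAddCommGroup p.Pre :=
  AddGroupSeminorm.toSeminormedAddCommGroup (E := Φ) p.toSeminorm.toAddGroupSeminorm

instance (p : HilbertSeminorm Φ) : NormedSpace ℝ p.Pre where
  toModule := inferInstanceAs (Module ℝ Φ)
  norm_smul_le r x := le_of_eq (map_smul_eq_mul p.toSeminorm r x)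

instance (p : HilbertSeminorm Φ) : InnerProductSpace ℝ p.Pre where
  inner x y := p.form x y
  norm_sq_eq_re_inner x := p.sq_eq_form x
  conj_inner_symm x y := p.form_symm y x
  add_left x y z := LinearMap.map_add₂ p.form x y z
  smul_left x y r := LinearMap.map_smul₂ p.form r x y

/-- The Hilbert space `Φ_p`: the (Hausdorff) completion of `Φ` for the seminorm `p`. -/
abbrev Space (p : HilbertSeminorm Φ) : Type _ := UniformSpace.Completion p.Pre

/-- The identity `Φ → (Φ, p)`, continuous because `p` is continuous. -/
def toPre [IsTopologicalAddGroup Φ] (p : HilbertSeminorm Φ) : Φ →L[ℝ] p.Pre where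
  toFun := fun φ => φ
  map_add' := fun _ _ => rfl
  map_smul' := fun _ _ => rfl
  cont := by
    refine continuous_iff_continuousAt.mpr fun φ => ?_
    refine tendsto_iff_norm_sub_tendsto_zero.mpr ?_
    have h : Continuous fun ψ : Φ => p.toSeminorm (ψ - φ) :=
      p.continuous_toSeminorm.comp (continuous_id.sub continuous_const)
    have h2 := h.tendsto φ
    rw [sub_self, map_zero] at h2
    exact h2

/-- The canonical map `i_p : Φ → Φ_p`. -/
def toSpace [IsTopologicalAddGroup Φ] (p : HilbertSeminorm Φ) : Φ →L[ℝ] p.Space :=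
  (UniformSpace.Completion.toComplL (𝕜 := ℝ) (E := p.Pre)).comp p.toPre

/-- The identity `(Φ, q) → (Φ, p)` for `p ≤ q`. -/
def preInclusion (p q : HilbertSeminorm Φ) (h : p.toSeminorm ≤ q.toSeminorm) :
    q.Pre →L[ℝ] p.Pre :=
  LinearMap.mkContinuous
    { toFun := fun φ : Φ => φ
      map_add' := fun _ _ => rfl
      map_smul' := fun _ _ => rfl } 1
    (fun φ => by rw [one_mul]; exact h φ)

/-- The canonical map `i_{p,q} : Φ_q → Φ_p` for `p ≤ q`. -/
def inclusion (p q : HilbertSeminorm Φ) (h : p.toSeminorm ≤ q.toSeminorm) :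
    q.Space →L[ℝ] p.Space :=
  (preInclusion p q h).completion

end HilbertSeminorm

/-- A bounded operator between Hilbert spaces is Hilbert–Schmidt if the squared norms of its
values on a Hilbert basis are summable. (The sum does not depend on the basis.) -/
def IsHilbertSchmidt {H K : Type*} [NormedAddCommGroup H] [InnerProductSpace ℝ H]
    [NormedAddCommGroup K] [InnerProductSpace ℝ K] (S : H →L[ℝ] K) : Prop :=
  ∃ (w : Set H) (b : HilbertBasis w ℝ H), Summable fun i => ‖S (b i)‖ ^ 2

/-- The topology of `Φ` is generated by a family `P` of Hilbertian seminorms such that every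
`p ∈ P` is dominated by some `q ∈ P` for which `i_{p,q}` is Hilbert–Schmidt. Together with the
Hausdorff property this says that `Φ` is a nuclear space. -/
def IsNuclear (Φ : Type*) [AddCommGroup Φ] [Module ℝ Φ] [TopologicalSpace Φ] : Prop :=
  ∃ P : Set (HilbertSeminorm Φ),
    WithSeminorms (𝕜 := ℝ) (E := Φ) (fun p : P => p.1.toSeminorm) ∧
    ∀ p ∈ P, ∃ q ∈ P, ∃ h : p.toSeminorm ≤ q.toSeminorm,
      IsHilbertSchmidt (HilbertSeminorm.inclusion p q h)

/-! ### Skorokhod spaces over duals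

`StrongDual ℝ Φ` is the topological dual with the topology of uniform convergence on bounded sets,
i.e. the strong dual of `Φ`; for a normed space this is the topology of the dual norm. -/

section Dual

variable {Φ : Type*} [AddCommGroup Φ] [Module ℝ Φ] [TopologicalSpace Φ]
  [IsTopologicalAddGroup Φ] [ContinuousSMul ℝ Φ]

/-- The space projection `x ↦ x[φ] = (x(t)[φ])_t` from the Skorokhod space over the strong dual
to the real Skorokhod space. -/
def spaceProjection (T : ℝ) (φ : Φ) : CadlagMap T (StrongDual ℝ Φ) → CadlagMap T ℝ :=
  CadlagMap.map (fun f : StrongDual ℝ Φ => f φ) (continuous_eval_const φ)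

/-- The canonical inclusion of the Hilbert space dual of `Φ_q` into the strong dual of `Φ`,
i.e. the dual operator of `i_q`. -/
def dualInclusion (q : HilbertSeminorm Φ) : StrongDual ℝ q.Space →L[ℝ] StrongDual ℝ Φ :=
  ContinuousLinearMap.precomp ℝ q.toSpace

/-- The canonical inclusion of the Skorokhod space over the dual of `Φ_q` into the Skorokhod
space over the strong dual of `Φ`. -/
def skorokhodInclusion (T : ℝ) (q : HilbertSeminorm Φ) :
    CadlagMap T (StrongDual ℝ q.Space) → CadlagMap T (StrongDual ℝ Φ) :=
  CadlagMap.map (dualInclusion q) (dualInclusion q).continuous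

/-- `A` is contained in the Skorokhod space over the dual of `Φ_q` and compact there. -/
def IsCompactIn {T : ℝ} (q : HilbertSeminorm Φ) (A : Set (CadlagMap T (StrongDual ℝ Φ))) : Prop :=
  A ⊆ range (skorokhodInclusion T q) ∧ IsCompact (skorokhodInclusion T q ⁻¹' A)

/-- `A` is contained in the Skorokhod space over the dual of `Φ_q` and relatively compact there. -/
def IsRelativelyCompactIn {T : ℝ} (q : HilbertSeminorm Φ)
    (A : Set (CadlagMap T (StrongDual ℝ Φ))) : Prop :=
  A ⊆ range (skorokhodInclusion T q) ∧ IsCompact (closure (skorokhodInclusion T q ⁻¹' A))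

end Dual

end

end SkorokhodDual

namespace SkorokhodDual

/-! ### Skorokhod convergence and time changes. -/

section Skorokhod

variable {T : ℝ} {E F : Type*} [AddCommGroup E] [Module ℝ E] [TopologicalSpace E]
  [AddCommGroup F] [Module ℝ F] [TopologicalSpace F] {ι : Type*}

/-! The implications (1) ⇒ (2) and (3) ⇒ (1) only use continuity: a continuous linear map `E → F`
induces a continuous map between Skorokhod spaces, and both the projections and the inclusion of the
Skorokhod space over `Φ'_q` arise this way.

For (2) ⇒ (3), compactness of each projection bounds `x(t)[φ]` uniformly in `x ∈ A` and `t`. On a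
barrelled space the pointwise supremum of these functionals is a continuous seminorm `p`. By
nuclearity the polar of `p` lies in a norm-compact subset `K` of some `Φ'_q`
(`exists_isCompact_dual`): Hilbert–Schmidt operators are compact, and functionals dominated by a
compact operator form a norm-compact set. Hence every path of `A` takes its values in `K`, where
convergence is detected by the coordinates `φ`, and so it is càdlàg in `Φ'_q`.

It remains to upgrade Skorokhod compactness of every coordinate to compactness in `Φ'_q`
(`isCompact_cadlagMap_of_coordinates`). The difficulty is that each coordinate converges with its
own time changes. Along an ultrafilter, J1 convergence to `y` is encoded by local data: for each
`t`, switching times `s i → t` such that values at times near `t` converge to `y t` from `s i` on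
and to the left limit before it (`IsSwitch`). Any limit value `z` of the paths at times tending to
`t` agrees, in each coordinate, with `a = y t` or with the left limit `b`. The coordinates where it
agrees with `a` form a subgroup, as do those where it agrees with `b`; a group is not the union of
two proper subgroups, so `z = a` or `z = b`. Then one coordinate separating `a` from `b` supplies
switching times for the whole path (`exists_isSwitch_of_coordinates`). Finally, the switching times
at the finitely many large jumps are glued into one global time change (`tendsto_of_isSwitch`). -/

theorem CadlagMap.ext {G : Type*} [TopologicalSpace G] {x y : CadlagMap T G} (h : ∀ t, x t = y t) : x = y := by
  cases x
  cases y
  congr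
  exact funext h

theorem tendsto_cadlagMap_iff {l : Filter ι} {X : ι → CadlagMap T E} {y : CadlagMap T E} :
    Tendsto X l (𝓝 y) ↔ ∀ p : Seminorm ℝ E, Continuous p →
      Tendsto (fun i => skorokhodEDist p (X i) y) l (𝓝 0) := by
  have h : 𝓝 y = ⨅ p : {p : Seminorm ℝ E // Continuous p},
      @nhds _ (skorokhodPseudoEMetric T p.1).toUniformSpace.toTopologicalSpace y := by
    refine Eq.trans ?_ (@nhds_iInf (CadlagMap T E) _ (fun p : {p : Seminorm ℝ E // Continuous p} =>
      (skorokhodPseudoEMetric T p.1).toUniformSpace.toTopologicalSpace) y)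
    exact congrArg (fun t => @nhds _ t y) UniformSpace.toTopologicalSpace_iInf
  rw [h, tendsto_iInf, Subtype.forall]
  exact forall₂_congr fun p _ =>
    @tendsto_iff_edist_tendsto_0 _ _ (skorokhodPseudoEMetric T p) _ _ _

/-- For a continuous seminorm `p` on `F`, the Skorokhod distance of the images for `p` equals that
of the originals for the continuous seminorm `p ∘ f`. -/
theorem continuous_cadlagMap_map (f : E →ₗ[ℝ] F) (hf : Continuous f) :
    Continuous (CadlagMap.map (T := T) f hf) := by
  refine continuous_iff_continuousAt.mpr fun y => tendsto_cadlagMap_iff.mpr fun p hp => ?_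
  have h := tendsto_cadlagMap_iff.mp (tendsto_id (x := 𝓝 y)) (p.comp f) (hp.comp hf)
  simpa [skorokhodEDist, CadlagMap.map] using h

/-! ### Time changes -/

theorem timeChange_zero (hT : 0 ≤ T) (μ : TimeChange T) :
    μ ⟨0, left_mem_Icc.mpr hT⟩ = ⟨0, left_mem_Icc.mpr hT⟩ := by
  refine le_antisymm ?_ (μ _).2.1
  rw [← μ.le_symm_apply]
  exact (μ.symm _).2.1

theorem timeChange_last (hT : 0 ≤ T) (μ : TimeChange T) :
    μ ⟨T, right_mem_Icc.mpr hT⟩ = ⟨T, right_mem_Icc.mpr hT⟩ := by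
  refine le_antisymm (μ _).2.2 ?_
  rw [← μ.symm_apply_le]
  exact (μ.symm _).2.2

/-- Since `μ` fixes `0`, the slope bound on the interval `[0, t]` gives `exp (-η) ≤ μ t / t ≤ exp
η`. -/
theorem abs_timeChange_sub_le (μ : TimeChange T) {η : ℝ}
    (h : timeChangeCost μ ≤ ENNReal.ofReal η) (hη : 0 ≤ η) (t : Icc (0 : ℝ) T) :
    |(μ t : ℝ) - t| ≤ T * (Real.exp η - 1) := by
  have hT : 0 ≤ T := t.2.1.trans t.2.2
  have he : 1 ≤ Real.exp η := Real.one_le_exp hη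
  rcases t.2.1.eq_or_lt with h0 | h0
  · have : t = ⟨0, left_mem_Icc.mpr hT⟩ := Subtype.ext h0.symm
    rw [this, timeChange_zero hT, sub_self, abs_zero]
    exact mul_nonneg hT (by linarith)
  have hμ0 := timeChange_zero hT μ
  have hlt : (⟨0, left_mem_Icc.mpr hT⟩ : Icc (0 : ℝ) T) < t := h0
  have hb : ENNReal.ofReal |Real.log ((μ t : ℝ) / t)| ≤ ENNReal.ofReal η := by
    refine le_trans ?_ h
    refine le_trans (le_of_eq ?_) (le_iSup_of_le _ (le_iSup_of_le t (le_iSup_of_le hlt le_rfl)))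
    rw [hμ0, sub_zero, sub_zero]
  rw [ENNReal.ofReal_le_ofReal_iff hη, abs_le] at hb
  have hpos : 0 < (μ t : ℝ) := by
    have := μ.lt_iff_lt.mpr hlt
    rw [hμ0] at this
    exact this
  have hr : 0 < (μ t : ℝ) / t := div_pos hpos h0
  have h1 := (Real.log_le_iff_le_exp hr).mp hb.2
  have h2 := (Real.le_log_iff_exp_le hr).mp hb.1
  rw [div_le_iff₀ h0] at h1
  rw [le_div_iff₀ h0] at h2
  -- This is `exp η + exp (-η) ≥ 2`; it makes the lower displacement no larger than the upper one.
  have h3 : 2 - Real.exp η ≤ Real.exp (-η) := by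
    have : Real.exp η * Real.exp (-η) = 1 := by rw [← Real.exp_add]; simp
    nlinarith [Real.exp_pos (-η), sq_nonneg (Real.exp η - 1)]
  have h4 : (t : ℝ) * (Real.exp η - 1) ≤ T * (Real.exp η - 1) :=
    mul_le_mul_of_nonneg_right t.2.2 (by linarith)
  rw [abs_le]
  constructor <;> nlinarith

theorem tendsto_timeChange_apply {l : Filter ι} {Λ : ι → TimeChange T}
    (hΛ : Tendsto (fun i => timeChangeCost (Λ i)) l (𝓝 0)) {σ : ι → Icc (0 : ℝ) T}
    {t : Icc (0 : ℝ) T} (hσ : Tendsto σ l (𝓝 t)) : Tendsto (fun i => Λ i (σ i)) l (𝓝 t) := by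
  rw [tendsto_subtype_rng] at hσ ⊢
  have hr : Tendsto (fun i => (timeChangeCost (Λ i)).toReal) l (𝓝 0) :=
    (ENNReal.tendsto_toReal ENNReal.zero_ne_top).comp hΛ
  have hb : Tendsto (fun i => T * (Real.exp (timeChangeCost (Λ i)).toReal - 1)) l (𝓝 0) := by
    have := (((Real.continuous_exp.tendsto 0).comp hr).sub_const 1).const_mul T
    simpa using this
  have hd : Tendsto (fun i => (Λ i (σ i) : ℝ) - σ i) l (𝓝 0) := by
    refine squeeze_zero_norm' ?_ hb
    filter_upwards [hΛ.eventually (gt_mem_nhds ENNReal.zero_lt_top)] with i hi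
    exact abs_timeChange_sub_le _ (ENNReal.ofReal_toReal hi.ne).ge ENNReal.toReal_nonneg _
  simpa using hd.add hσ

theorem tendsto_timeChangeCost_symm {l : Filter ι} {Λ : ι → TimeChange T}
    (hΛ : Tendsto (fun i => timeChangeCost (Λ i)) l (𝓝 0)) :
    Tendsto (fun i => timeChangeCost (Λ i).symm) l (𝓝 0) :=
  tendsto_of_tendsto_of_tendsto_of_le_of_le tendsto_const_nhds hΛ (fun _ => bot_le)
    fun i => timeChangeCost_symm_le (Λ i)

/-- A small Lipschitz perturbation of the identity fixing the end points is a time change. -/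
theorem exists_timeChange_add (hT : 0 ≤ T) {g : ℝ → ℝ} {L : ℝ} (hL : L ≤ 1 / 2)
    (hg : ∀ u v, |g u - g v| ≤ L * |u - v|) (h0 : g 0 = 0) (h1 : g T = 0) :
    ∃ μ : TimeChange T, (∀ u : Icc (0 : ℝ) T, (μ u : ℝ) = u + g u) ∧
      timeChangeCost μ ≤ ENNReal.ofReal (2 * L) := by
  have hmono : StrictMono fun u => u + g u := by
    intro u v huv
    have := hg u v
    rw [abs_sub_comm u v, abs_of_pos (sub_pos.mpr huv), abs_le] at this
    have h3 : L * (v - u) ≤ 1 / 2 * (v - u) :=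
      mul_le_mul_of_nonneg_right hL (sub_pos.mpr huv).le
    simp only
    linarith [this.2]
  have hcont : Continuous g := by
    have : LipschitzWith (Real.toNNReal L) g := by
      refine LipschitzWith.of_dist_le_mul fun u v => ?_
      rw [Real.dist_eq, Real.dist_eq]
      exact (hg u v).trans (mul_le_mul_of_nonneg_right (Real.le_coe_toNNReal L) (abs_nonneg _))
    exact this.continuous
  have hmem : ∀ u : Icc (0 : ℝ) T, (u : ℝ) + g u ∈ Icc (0 : ℝ) T := fun u =>
    ⟨by simpa [h0] using hmono.monotone u.2.1, by simpa [h1] using hmono.monotone u.2.2⟩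
  let f : Icc (0 : ℝ) T → Icc (0 : ℝ) T := fun u => ⟨u + g u, hmem u⟩
  have hf : StrictMono f := fun u v huv => hmono huv
  have hsurj : Function.Surjective f := by
    intro v
    have hv : (v : ℝ) ∈ Icc (0 + g 0) (T + g T) := by simp [h0, h1]
    obtain ⟨u, hu, huv⟩ :=
      intermediate_value_Icc hT (continuous_id.add hcont).continuousOn hv
    exact ⟨⟨u, hu⟩, Subtype.ext huv⟩
  refine ⟨hf.orderIsoOfSurjective f hsurj, fun u => rfl, ?_⟩
  refine iSup_le fun s => iSup_le fun t => iSup_le fun hst => ENNReal.ofReal_le_ofReal ?_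
  have hst' : 0 < (t : ℝ) - s := sub_pos.mpr hst
  set r : ℝ := (g t - g s) / (t - s) with hr
  have hrL : |r| ≤ L := by
    rw [hr, abs_div, abs_of_pos hst', div_le_iff₀ hst']
    simpa [abs_of_pos hst'] using hg t s
  have e : (((t : ℝ) + g t) - (s + g s)) / ((t : ℝ) - s) = 1 + r := by
    rw [hr]
    field_simp
    ring
  change |Real.log ((((t : ℝ) + g t) - (s + g s)) / ((t : ℝ) - s))| ≤ 2 * L
  rw [e]
  have hr2 := abs_le.mp (hrL.trans hL)
  have hp : 0 < 1 + r := by linarith [hr2.1]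
  have hr3 := abs_le.mp hrL
  rw [abs_le]
  constructor
  · have h5 := Real.one_sub_inv_le_log_of_pos hp
    -- Here `log (1 + r) ≥ r / (1 + r) ≥ -2L`, because `1 + r ≥ 1/2`; this is where the factor `2`
    -- in the cost comes from.
    have h6 : -(2 * L) ≤ 1 - (1 + r)⁻¹ := by
      have : 1 - (1 + r)⁻¹ = r / (1 + r) := by field_simp; ring
      rw [this, le_div_iff₀ hp]
      nlinarith [hr3.1, hr3.2, hr2.1]
    linarith
  · have h5 := Real.log_le_sub_one_of_pos hp
    linarith [hr3.2, hr3.1]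

/-- A trapezoidal function, equal to `1` at distance at most `δ` from `a` and to `0` at distance
at least `2 * δ`. -/
noncomputable def plateau (δ a u : ℝ) : ℝ := max 0 (min 1 (2 - |u - a| / δ))

theorem plateau_eq_one {δ a u : ℝ} (hδ : 0 < δ) (h : |u - a| ≤ δ) : plateau δ a u = 1 := by
  have : |u - a| / δ ≤ 1 := (div_le_one hδ).mpr h
  rw [plateau, min_eq_left (by linarith), max_eq_right zero_le_one]

theorem plateau_eq_zero {δ a u : ℝ} (hδ : 0 < δ) (h : 2 * δ ≤ |u - a|) : plateau δ a u = 0 := by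
  have : 2 ≤ |u - a| / δ := (le_div_iff₀ hδ).mpr h
  exact max_eq_left ((min_le_right _ _).trans (by linarith))

theorem abs_plateau_sub_le {δ a : ℝ} (hδ : 0 < δ) (u v : ℝ) :
    |plateau δ a u - plateau δ a v| ≤ |u - v| / δ := by
  have h1 : |(2 - |u - a| / δ) - (2 - |v - a| / δ)| ≤ |u - v| / δ := by
    have e : (2 - |u - a| / δ) - (2 - |v - a| / δ) = (|v - a| - |u - a|) / δ := by ring
    rw [e, abs_div, abs_of_pos hδ]
    have := abs_abs_sub_abs_le_abs_sub (v - a) (u - a)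
    rw [sub_sub_sub_cancel_right, abs_sub_comm v u] at this
    exact div_le_div_of_nonneg_right this hδ.le
  refine le_trans (abs_max_sub_max_le_max _ _ _ _) (max_le (by simp; positivity) ?_)
  exact le_trans (abs_min_sub_min_le_max _ _ _ _) (max_le (by simp; positivity) h1)

/-! ### Near-optimal time changes and switching times -/

/-- Near-optimal time changes for a convergent family. -/
theorem exists_timeChange_of_tendsto {l : Filter ι} {X : ι → CadlagMap T E} {y : CadlagMap T E}
    (h : Tendsto X l (𝓝 y)) (p : Seminorm ℝ E) (hp : Continuous p) {N : ι → ℝ≥0∞}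
    (hN0 : ∀ i, N i ≠ 0) (hN : Tendsto N l (𝓝 0)) :
    ∃ Λ : ι → TimeChange T, Tendsto (fun i => timeChangeCost (Λ i)) l (𝓝 0) ∧
      ∀ σ : ι → Icc (0 : ℝ) T, Tendsto (fun i => p (X i (σ i) - y (Λ i (σ i)))) l (𝓝 0) := by
  have hex : ∀ i, ∃ μ : TimeChange T, (⨆ t, ENNReal.ofReal (p (X i t - y (μ t))))
      + timeChangeCost μ ≤ skorokhodEDist p (X i) y + N i := by
    intro i
    -- When the distance is infinite there is nothing to optimise, and the identity serves.
    by_cases hi : skorokhodEDist p (X i) y = ∞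
    · exact ⟨OrderIso.refl _, by simp [hi]⟩
    · obtain ⟨μ, hμ⟩ := iInf_lt_iff.mp (ENNReal.lt_add_right hi (hN0 i))
      exact ⟨μ, hμ.le⟩
  choose Λ hΛ using hex
  have hlim : Tendsto (fun i => skorokhodEDist p (X i) y + N i) l (𝓝 0) := by
    simpa using (tendsto_cadlagMap_iff.mp h p hp).add hN
  refine ⟨Λ, tendsto_of_tendsto_of_tendsto_of_le_of_le tendsto_const_nhds hlim (fun _ => bot_le)
    fun i => le_add_self.trans (hΛ i), fun σ => ?_⟩
  have h2 : Tendsto (fun i => ENNReal.ofReal (p (X i (σ i) - y (Λ i (σ i))))) l (𝓝 0) :=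
    tendsto_of_tendsto_of_tendsto_of_le_of_le tendsto_const_nhds hlim (fun _ => bot_le)
      fun i => (le_iSup (fun t => ENNReal.ofReal (p (X i t - y (Λ i t)))) (σ i)).trans
        (le_self_add.trans (hΛ i))
  have h3 := (ENNReal.tendsto_toReal ENNReal.zero_ne_top).comp h2
  refine h3.congr fun i => ?_
  exact ENNReal.toReal_ofReal (apply_nonneg p _)

/-- The times `s` separate, near `t`, the times at which `X` is close to `a` from the
earlier ones, at which it is close to `b`. -/
def IsSwitch {G : Type*} [TopologicalSpace G] (l : Filter ι) (X : ι → Icc (0 : ℝ) T → G)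
    (t : Icc (0 : ℝ) T) (a b : G) (s : ι → Icc (0 : ℝ) T) : Prop :=
  Tendsto s l (𝓝 t) ∧ ∀ σ : ι → Icc (0 : ℝ) T, Tendsto σ l (𝓝 t) →
    ((∀ᶠ i in l, s i ≤ σ i) → Tendsto (fun i => X i (σ i)) l (𝓝 a)) ∧
    ((∀ᶠ i in l, σ i < s i) → Tendsto (fun i => X i (σ i)) l (𝓝 b))

theorem IsSwitch.tendsto_or {G : Type*} [TopologicalSpace G] {U : Ultrafilter ι}
    {X : ι → Icc (0 : ℝ) T → G} {t : Icc (0 : ℝ) T} {a b : G} {s : ι → Icc (0 : ℝ) T}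
    (h : IsSwitch (U : Filter ι) X t a b s) {σ : ι → Icc (0 : ℝ) T} (hσ : Tendsto σ U (𝓝 t)) :
    Tendsto (fun i => X i (σ i)) U (𝓝 a) ∨ Tendsto (fun i => X i (σ i)) U (𝓝 b) := by
  rcases U.em fun i => s i ≤ σ i with h1 | h1
  · exact Or.inl ((h.2 σ hσ).1 h1)
  · exact Or.inr ((h.2 σ hσ).2 (h1.mono fun i hi => not_le.mp hi))

theorem CadlagMap.tendsto_of_le {G : Type*} [TopologicalSpace G] (y : CadlagMap T G) {l : Filter ι} {σ : ι → Icc (0 : ℝ) T}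
    {t : Icc (0 : ℝ) T} (hσ : Tendsto σ l (𝓝 t)) (h : ∀ᶠ i in l, t ≤ σ i) :
    Tendsto (fun i => y (σ i)) l (𝓝 (y t)) :=
  (continuousWithinAt_Ioi_iff_Ici.mp (y.rightContinuous t)).tendsto.comp
    (tendsto_nhdsWithin_iff.mpr ⟨hσ, h⟩)

/-- The switching time is the preimage of `t` under the time change: `σ i` lies before it exactly
when `Λ i (σ i) < t`, where `y` is close to its left limit. -/
theorem isSwitch_of_timeChange {G : Type*} [NormedAddCommGroup G] [NormedSpace ℝ G]
    {l : Filter ι} {X : ι → CadlagMap T G} {y : CadlagMap T G} {Λ : ι → TimeChange T}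
    (hΛ : Tendsto (fun i => timeChangeCost (Λ i)) l (𝓝 0))
    (hX : ∀ σ : ι → Icc (0 : ℝ) T, Tendsto (fun i => X i (σ i) - y (Λ i (σ i))) l (𝓝 0))
    (t : Icc (0 : ℝ) T) {b : G} (hb : Tendsto y (𝓝[<] t) (𝓝 b)) :
    IsSwitch l (fun i => X i) t (y t) b (fun i => (Λ i).symm t) := by
  refine ⟨tendsto_timeChange_apply (tendsto_timeChangeCost_symm hΛ) tendsto_const_nhds,
    fun σ hσ => ⟨fun h => ?_, fun h => ?_⟩⟩
  · have h1 := y.tendsto_of_le (tendsto_timeChange_apply hΛ hσ)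
      (h.mono fun i hi => (Λ i).symm_apply_le.mp hi)
    simpa using (hX σ).add h1
  · have h1 : Tendsto (fun i => y (Λ i (σ i))) l (𝓝 b) :=
      hb.comp (tendsto_nhdsWithin_iff.mpr ⟨tendsto_timeChange_apply hΛ hσ,
        h.mono fun i hi => (Λ i).lt_symm_apply.mp hi⟩)
    simpa using (hX σ).add h1

end Skorokhod

/-! ### From local switching times to global Skorokhod convergence. -/

section Normed

variable {T : ℝ} {F : Type*} [NormedAddCommGroup F] [NormedSpace ℝ F] {ι : Type*}

theorem tendsto_of_eventually_exists_timeChange {l : Filter ι} {X : ι → CadlagMap T F}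
    {y : CadlagMap T F}
    (h : ∀ ε > 0, ∀ᶠ i in l, ∃ μ : TimeChange T, (∀ u, ‖X i u - y (μ u)‖ ≤ ε) ∧
      timeChangeCost μ ≤ ENNReal.ofReal ε) : Tendsto X l (𝓝 y) := by
  refine tendsto_cadlagMap_iff.mpr fun p hp => ?_
  obtain ⟨C, hC, hpC⟩ := Seminorm.bound_of_continuous_normedSpace p hp
  have hlim : Tendsto (fun ε : ℝ => ENNReal.ofReal (C * ε) + ENNReal.ofReal ε) (𝓝[>] 0) (𝓝 0) := by
    have : Continuous fun ε : ℝ => ENNReal.ofReal (C * ε) + ENNReal.ofReal ε :=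
      (ENNReal.continuous_ofReal.comp (continuous_const.mul continuous_id)).add
        ENNReal.continuous_ofReal
    have h2 := this.tendsto 0
    simp only [mul_zero, ENNReal.ofReal_zero, add_zero] at h2
    exact h2.mono_left nhdsWithin_le_nhds
  refine ENNReal.tendsto_nhds_zero.mpr fun η hη => ?_
  obtain ⟨ε, hε, hε0⟩ :=
    ((ENNReal.tendsto_nhds_zero.mp hlim η hη).and self_mem_nhdsWithin).exists
  filter_upwards [h ε hε0] with i hi
  obtain ⟨μ, h1, h2⟩ := hi
  refine le_trans (iInf_le_of_le μ (add_le_add (iSup_le fun t => ?_) h2)) hε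
  exact ENNReal.ofReal_le_ofReal
    ((hpC _).trans (mul_le_mul_of_nonneg_left (h1 t) hC.le))

theorem neBot_nhdsLT_of_pos {t : Icc (0 : ℝ) T} (ht : 0 < (t : ℝ)) : (𝓝[<] t).NeBot := by
  have hT : 0 ≤ T := t.2.1.trans t.2.2
  exact nhdsLT_neBot_of_exists_lt ⟨⟨0, left_mem_Icc.mpr hT⟩, ht⟩

/-- A point `u` of the open set `S` near `t` has nearby points that also lie in `S` and near `t`, so
both `y u` and the left limit at `u` are within `ε / 2` of `c`. With `S` the points after or before
`t`, this excludes accumulation of large jumps. -/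
theorem eventually_jump_le {G : Type*} [NormedAddCommGroup G] {y : Icc (0 : ℝ) T → G} {t : Icc (0 : ℝ) T} {S : Set (Icc (0 : ℝ) T)}
    (hS : IsOpen S) {c : G} (hc : Tendsto y (𝓝[S] t) (𝓝 c)) {ε : ℝ} (hε : 0 < ε) :
    ∀ᶠ u : Icc (0 : ℝ) T in 𝓝[S] t, 0 < (u : ℝ) → ∀ b, Tendsto y (𝓝[<] u) (𝓝 b) → ‖y u - b‖ ≤ ε := by
  have h1 : ∀ᶠ u in 𝓝[S] t, ‖y u - c‖ ≤ ε / 2 := by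
    have := hc.eventually (Metric.closedBall_mem_nhds c (half_pos hε))
    simpa [dist_eq_norm] using this
  filter_upwards [h1, eventually_eventually_nhdsWithin.mpr h1, self_mem_nhdsWithin]
    with u hu hu2 huS hu0 b hb
  rw [hS.nhdsWithin_eq huS] at hu2
  have := neBot_nhdsLT_of_pos hu0
  have h2 : ‖b - c‖ ≤ ε / 2 :=
    le_of_tendsto (hb.sub_const c).norm (hu2.filter_mono nhdsWithin_le_nhds)
  calc ‖y u - b‖ = ‖(y u - c) - (b - c)‖ := by rw [sub_sub_sub_cancel_right]
    _ ≤ ‖y u - c‖ + ‖b - c‖ := norm_sub_le _ _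
    _ ≤ ε := by linarith

/-- A càdlàg map has finitely many jumps larger than a given positive number. -/
theorem CadlagMap.finite_jumps {G : Type*} [NormedAddCommGroup G] (y : CadlagMap T G)
    {b : Icc (0 : ℝ) T → G}
    (hb : ∀ t, Tendsto y (𝓝[<] t) (𝓝 (b t))) {ε : ℝ} (hε : 0 < ε) :
    {t : Icc (0 : ℝ) T | 0 < (t : ℝ) ∧ ε < ‖y t - b t‖}.Finite := by
  by_contra hinf
  obtain ⟨t, -, ht⟩ := Set.Infinite.exists_accPt_of_subset_isCompact hinf isCompact_univ
    (subset_univ _)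
  have h1 := eventually_jump_le isOpen_Ioi (y.rightContinuous t) hε
  have h2 := eventually_jump_le isOpen_Iio (hb t) hε
  have h3 := eventually_sup.mpr ⟨h2, h1⟩
  rw [nhdsLT_sup_nhdsGT] at h3
  obtain ⟨u, hu, hu2⟩ := ((accPt_iff_frequently_nhdsNE.mp ht).and_eventually h3).exists
  exact absurd (hu2 hu.1 _ (hb u)) (not_le.mpr hu.2)

/-- Convergence in the Skorokhod space from the existence of switching times. -/
theorem tendsto_of_isSwitch (hT : 0 < T) {U : Ultrafilter ι} {X : ι → CadlagMap T F}
    {y : CadlagMap T F}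
    (h : ∀ t b, Tendsto y (𝓝[<] t) (𝓝 b) → ∃ s : ι → Icc (0 : ℝ) T,
      IsSwitch (U : Filter ι) (fun i => X i) t (y t) b s ∧
      ((∀ μ : TimeChange T, μ t = t) → ∀ i, s i = t)) :
    Tendsto X U (𝓝 y) := by
  choose b hb using y.leftLimits
  choose s hs hs0 using fun t => h t (b t) (hb t)
  refine tendsto_of_eventually_exists_timeChange fun ε' hε' => ?_
  obtain ⟨ε, hε, rfl⟩ : ∃ ε, 0 < ε ∧ 2 * ε = ε' := ⟨ε' / 2, half_pos hε', by ring⟩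
  set o : Icc (0 : ℝ) T := ⟨0, left_mem_Icc.mpr hT.le⟩ with ho
  set e : Icc (0 : ℝ) T := ⟨T, right_mem_Icc.mpr hT.le⟩ with he
  have hfin := (y.finite_jumps hb hε).union (Set.toFinite {o, e})
  set D := hfin.toFinset with hD
  have hoD : o ∈ D := by simp [hD]
  have heD : e ∈ D := by simp [hD]
  have hoe : o ≠ e := fun h => hT.ne (congrArg Subtype.val h)
  have hjump : ∀ t ∉ D, ‖y t - b t‖ ≤ ε := by
    intro t ht
    have h1 : t ≠ o := fun h => ht (h ▸ hoD)
    have h2 : 0 < (t : ℝ) := lt_of_le_of_ne t.2.1 fun h => h1 (Subtype.ext h.symm)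
    by_contra h3
    exact ht (by simp [hD, h2, not_le.mp h3])
  -- At distance at most `δ` from one point of `D`, every other point of `D` is at distance at least
  -- `2 * δ`, so its plateau vanishes there.
  obtain ⟨δ, hδ, hsep⟩ : ∃ δ : ℝ, 0 < δ ∧ ∀ a ∈ D, ∀ c ∈ D, a ≠ c → 3 * δ ≤ |(a : ℝ) - c| := by
    have hpos : 0 < (D : Set (Icc (0 : ℝ) T)).infsep :=
      (D.finite_toSet.infsep_pos_iff_nontrivial).mpr ⟨o, hoD, e, heD, hoe⟩
    refine ⟨(D : Set (Icc (0 : ℝ) T)).infsep / 3, by positivity, fun a ha c hc hac => ?_⟩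
    have := (Set.Nontrivial.le_infsep_iff (s := (D : Set (Icc (0 : ℝ) T)))
      ⟨o, hoD, e, heD, hoe⟩).mp le_rfl a ha c hc hac
    rw [Subtype.dist_eq, Real.dist_eq] at this
    linarith
  -- The map `u + g i u` is a translation by `a - s a i` within `δ` of each `a ∈ D`, so it carries
  -- the switching time `s a i` to `a` once that time is within `δ` of `a`.
  let g : ι → ℝ → ℝ := fun i u => ∑ a ∈ D, ((a : ℝ) - s a i) * plateau δ a u
  let L : ι → ℝ := fun i => ∑ a ∈ D, |(a : ℝ) - s a i| / δ
  have hg : ∀ i u v, |g i u - g i v| ≤ L i * |u - v| := by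
    intro i u v
    simp only [g, L, ← Finset.sum_sub_distrib, Finset.sum_mul]
    refine (Finset.abs_sum_le_sum_abs _ _).trans (Finset.sum_le_sum fun a _ => ?_)
    rw [← mul_sub, abs_mul, div_mul_eq_mul_div, mul_div_assoc]
    exact mul_le_mul_of_nonneg_left (abs_plateau_sub_le hδ u v) (abs_nonneg _)
  have hgD : ∀ i, ∀ a ∈ D, ∀ u : ℝ, |u - a| ≤ δ → g i u = (a : ℝ) - s a i := by
    intro i a ha u hu
    simp only [g]
    rw [Finset.sum_eq_single_of_mem a ha, plateau_eq_one hδ hu, mul_one]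
    intro c hc hca
    have h1 := hsep a ha c hc hca.symm
    have h2 := abs_sub_le (a : ℝ) u c
    rw [abs_sub_comm (a : ℝ) u] at h2
    rw [plateau_eq_zero hδ (by linarith), mul_zero]
  -- The end points belong to `D`, and their switching times are the end points themselves because
  -- every time change fixes them.
  have hg0 : ∀ i, g i 0 = 0 := fun i => by
    rw [hgD i o hoD 0 (by simp [ho, hδ.le]), hs0 o (timeChange_zero hT.le), sub_self]
  have hgT : ∀ i, g i T = 0 := fun i => by
    rw [hgD i e heD T (by simp [he, hδ.le]), hs0 e (timeChange_last hT.le), sub_self]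
  have hsub : ∀ a : Icc (0 : ℝ) T, Tendsto (fun i => |(a : ℝ) - s a i|) U (𝓝 0) := by
    intro a
    have := (tendsto_const_nhds (x := (a : ℝ))).sub (tendsto_subtype_rng.mp (hs a).1)
    simpa using this.abs
  have hL : Tendsto L U (𝓝 0) := by
    have := tendsto_finsetSum D fun a _ => (hsub a).div_const δ
    simpa using this
  have hex : ∀ i, ∃ μ : TimeChange T, L i ≤ 1 / 2 →
      (∀ u : Icc (0 : ℝ) T, (μ u : ℝ) = u + g i u) ∧
        timeChangeCost μ ≤ ENNReal.ofReal (2 * L i) := by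
    intro i
    by_cases hi : L i ≤ 1 / 2
    · obtain ⟨μ, hμ⟩ := exists_timeChange_add hT.le hi (hg i) (hg0 i) (hgT i)
      exact ⟨μ, fun _ => hμ⟩
    · exact ⟨OrderIso.refl _, fun h => absurd h hi⟩
  choose Λ hΛ using hex
  have hL2 : ∀ᶠ i in (U : Filter ι), L i ≤ 1 / 2 := hL.eventually (ge_mem_nhds (by norm_num))
  have hcost : Tendsto (fun i => timeChangeCost (Λ i)) U (𝓝 0) := by
    have h1 : Tendsto (fun i => ENNReal.ofReal (2 * L i)) U (𝓝 0) := by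
      simpa using ENNReal.tendsto_ofReal (hL.const_mul 2)
    exact tendsto_of_tendsto_of_tendsto_of_le_of_le' tendsto_const_nhds h1
      (Eventually.of_forall fun _ => bot_le) (hL2.mono fun i hi => (hΛ i hi).2)
  have hΛs : ∀ a ∈ D, ∀ᶠ i in (U : Filter ι), Λ i (s a i) = a := by
    intro a ha
    filter_upwards [hL2, (hsub a).eventually (ge_mem_nhds hδ)] with i h1 h2
    refine Subtype.ext ?_
    rw [(hΛ i h1).1, hgD i a ha _ (by rwa [abs_sub_comm])]
    ring
  have hcost2 : ∀ᶠ i in (U : Filter ι), timeChangeCost (Λ i) ≤ ENNReal.ofReal (2 * ε) :=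
    hcost.eventually (ge_mem_nhds (by simpa using hε))
  suffices hsup : ∀ᶠ i in (U : Filter ι), ∀ u, ‖X i u - y (Λ i u)‖ ≤ 2 * ε by
    filter_upwards [hsup, hcost2] with i h1 h2 using ⟨Λ i, h1, h2⟩
  -- If uniform closeness fails, the ultrafilter selects bad times `σ i`, which converge to some `t`
  -- by compactness. The local data at `t` then contradict the gap `2 * ε`.
  by_contra hcon
  rw [← Ultrafilter.eventually_not] at hcon
  have hex2 : ∀ i, ∃ u, (¬ ∀ u, ‖X i u - y (Λ i u)‖ ≤ 2 * ε) → 2 * ε < ‖X i u - y (Λ i u)‖ := by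
    intro i
    by_cases hi : ∀ u, ‖X i u - y (Λ i u)‖ ≤ 2 * ε
    · exact ⟨o, fun h => absurd hi h⟩
    · obtain ⟨u, hu⟩ := not_forall.mp hi
      exact ⟨u, fun _ => not_le.mp hu⟩
  choose σ hσ using hex2
  obtain ⟨t, ht⟩ : ∃ t, Tendsto σ U (𝓝 t) := ⟨_, (U.map σ).le_nhds_lim⟩
  have hΛσ := tendsto_timeChange_apply hcost ht
  have hbig : ∀ᶠ i in (U : Filter ι), 2 * ε ≤ ‖X i (σ i) - y (Λ i (σ i))‖ :=
    hcon.mono fun i hi => (hσ i hi).le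
  have hfinal : ∀ A B : F, Tendsto (fun i => X i (σ i)) U (𝓝 A) →
      Tendsto (fun i => y (Λ i (σ i))) U (𝓝 B) → ‖A - B‖ ≤ ε → False := by
    intro A B hA hB hAB
    have := ge_of_tendsto (hA.sub hB).norm hbig
    linarith
  have hyge : (∀ᶠ i in (U : Filter ι), t ≤ Λ i (σ i)) →
      Tendsto (fun i => y (Λ i (σ i))) U (𝓝 (y t)) := fun h => y.tendsto_of_le hΛσ h
  have hylt : (∀ᶠ i in (U : Filter ι), Λ i (σ i) < t) →
      Tendsto (fun i => y (Λ i (σ i))) U (𝓝 (b t)) := fun h =>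
    (hb t).comp (tendsto_nhdsWithin_iff.mpr ⟨hΛσ, h⟩)
  by_cases htD : t ∈ D
  · rcases U.em fun i => s t i ≤ σ i with h1 | h1
    · refine hfinal _ _ (((hs t).2 σ ht).1 h1) (hyge ?_) (by simpa using hε.le)
      filter_upwards [hΛs t htD, h1] with i h2 h3
      rw [← h2]
      exact (Λ i).monotone h3
    · have h1' : ∀ᶠ i in (U : Filter ι), σ i < s t i := h1.mono fun i hi => not_le.mp hi
      refine hfinal _ _ (((hs t).2 σ ht).2 h1') (hylt ?_) (by simpa using hε.le)
      filter_upwards [hΛs t htD, h1'] with i h2 h3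
      rw [← h2]
      exact (Λ i).strictMono h3
  -- Here the time change need not align with the switching times at `t`: both limits lie in `{y t,
  -- b t}`, two points at distance at most `ε`.
  · have hj := hjump t htD
    have hj' : ‖b t - y t‖ ≤ ε := by rwa [norm_sub_rev]
    have hy : Tendsto (fun i => y (Λ i (σ i))) U (𝓝 (y t)) ∨
        Tendsto (fun i => y (Λ i (σ i))) U (𝓝 (b t)) := by
      rcases U.em fun i => t ≤ Λ i (σ i) with h1 | h1
      · exact Or.inl (hyge h1)
      · exact Or.inr (hylt (h1.mono fun i hi => not_le.mp hi))
    rcases (hs t).tendsto_or ht with h1 | h1 <;> rcases hy with h2 | h2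
    · exact hfinal _ _ h1 h2 (by simpa using hε.le)
    · exact hfinal _ _ h1 h2 hj
    · exact hfinal _ _ h1 h2 hj'
    · exact hfinal _ _ h1 h2 (by simpa using hε.le)

end Normed

/-! ### Compactness in the Skorokhod space from compactness of coordinates. -/

section Coordinates

variable {T : ℝ} {F : Type*} [NormedAddCommGroup F] [NormedSpace ℝ F] {Φ ι : Type*}
  {K : Set F} {ev : Φ → F →L[ℝ] ℝ}

/-- Every cluster point in `K` has coordinates `c`, so separation leaves only one, and in a compact
set a unique cluster point is a limit. -/
theorem exists_tendsto_of_coordinates (hK : IsCompact K)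
    (hsep : ∀ z w, (∀ φ, ev φ z = ev φ w) → z = w) {l : Filter ι} [l.NeBot] {f : ι → F}
    (hf : ∀ᶠ i in l, f i ∈ K) {c : Φ → ℝ}
    (hc : ∀ φ, Tendsto (fun i => ev φ (f i)) l (𝓝 (c φ))) :
    ∃ z ∈ K, Tendsto f l (𝓝 z) ∧ ∀ φ, ev φ z = c φ := by
  have key : ∀ z, MapClusterPt z l f → ∀ φ, ev φ z = c φ := by
    intro z hz φ
    obtain ⟨U, hU, hUz⟩ := mapClusterPt_iff_ultrafilter.mp hz
    exact tendsto_nhds_unique (((ev φ).continuous.tendsto z).comp hUz) ((hc φ).mono_left hU)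
  obtain ⟨z, hzK, hz⟩ := hK (f := map f l) (le_principal_iff.mpr hf)
  refine ⟨z, hzK, hK.tendsto_nhds_of_unique_mapClusterPt hf fun w _ hw => ?_, key z hz⟩
  exact hsep _ _ fun φ => (key w hw φ).trans (key z hz φ).symm

/-- A map into a compact set whose coordinates are càdlàg is càdlàg. -/
def CadlagMap.ofCoordinates (hK : IsCompact K) (hsep : ∀ z w, (∀ φ, ev φ z = ev φ w) → z = w)
    (x : Icc (0 : ℝ) T → F) (hx : ∀ t, x t ∈ K) (Y : Φ → CadlagMap T ℝ)
    (hY : ∀ φ t, ev φ (x t) = Y φ t) : CadlagMap T F where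
  toFun := x
  rightContinuous t := by
    rcases (𝓝[>] t).eq_or_neBot with h | h
    · rw [ContinuousWithinAt, h]
      exact tendsto_bot
    obtain ⟨z, -, hz, hzc⟩ := exists_tendsto_of_coordinates hK hsep (l := 𝓝[>] t) (f := x)
      (Eventually.of_forall hx) (c := fun φ => Y φ t) fun φ => by
        simp only [hY]
        exact (Y φ).rightContinuous t
    rwa [hsep z (x t) fun φ => (hzc φ).trans (hY φ t).symm] at hz
  leftLimits t := by
    rcases (𝓝[<] t).eq_or_neBot with h | h
    · exact ⟨0, h ▸ tendsto_bot⟩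
    choose c hc using fun φ => (Y φ).leftLimits t
    obtain ⟨z, -, hz, -⟩ := exists_tendsto_of_coordinates hK hsep (l := 𝓝[<] t) (f := x)
      (Eventually.of_forall hx) (c := c) fun φ => by
        simp only [hY]
        exact hc φ
    exact ⟨z, hz⟩

variable [AddCommGroup Φ]

/-- Switching times of all coordinates yield a switching time: a group is not the union of two
proper subgroups. -/
theorem exists_isSwitch_of_coordinates (hK : IsCompact K)
    (hadd : ∀ φ ψ, ev (φ + ψ) = ev φ + ev ψ) (hsep : ∀ z w, (∀ φ, ev φ z = ev φ w) → z = w)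
    {U : Ultrafilter ι} {X : ι → Icc (0 : ℝ) T → F} (hX : ∀ᶠ i in (U : Filter ι), ∀ t, X i t ∈ K)
    {t : Icc (0 : ℝ) T} {a b : F} {s : Φ → ι → Icc (0 : ℝ) T}
    (hs : ∀ φ, IsSwitch (U : Filter ι) (fun i u => ev φ (X i u)) t (ev φ a) (ev φ b) (s φ)) :
    ∃ s' : ι → Icc (0 : ℝ) T, IsSwitch (U : Filter ι) X t a b s' ∧
      ((∀ φ i, s φ i = t) → ∀ i, s' i = t) := by
  have hlim : ∀ σ : ι → Icc (0 : ℝ) T, Tendsto σ U (𝓝 t) →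
      ∃ z, Tendsto (fun i => X i (σ i)) U (𝓝 z) ∧ (z = a ∨ z = b) := by
    intro σ hσ
    obtain ⟨z, -, hz⟩ := hK.ultrafilter_le_nhds (U.map fun i => X i (σ i))
      (le_principal_iff.mpr (hX.mono fun i hi => hi _))
    have hzt : Tendsto (fun i => X i (σ i)) U (𝓝 z) := hz
    refine ⟨z, hzt, ?_⟩
    have hor : ∀ φ, ev φ z = ev φ a ∨ ev φ z = ev φ b := fun φ => by
      have h1 := ((ev φ).continuous.tendsto z).comp hzt
      exact ((hs φ).tendsto_or hσ).imp (tendsto_nhds_unique h1) (tendsto_nhds_unique h1)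
    by_contra hne
    obtain ⟨ha, hb⟩ := not_or.mp hne
    -- If `φ` distinguishes `z` from `a` and `ψ` distinguishes `z` from `b`, then `z` agrees with
    -- `b` on `φ` and with `a` on `ψ`, so `φ + ψ` distinguishes `z` from both.
    obtain ⟨φ, hφ⟩ := not_forall.mp fun h => ha (hsep _ _ h)
    obtain ⟨ψ, hψ⟩ := not_forall.mp fun h => hb (hsep _ _ h)
    have h1 := (hor φ).resolve_left hφ
    have h2 := (hor ψ).resolve_right hψ
    have h3 := hor (φ + ψ)
    simp only [hadd, add_apply] at h3
    rcases h3 with h3 | h3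
    · exact hφ (by linarith)
    · exact hψ (by linarith)
  by_cases hab : a = b
  · subst hab
    refine ⟨fun _ => t, ⟨tendsto_const_nhds, fun σ hσ => ?_⟩, fun _ _ => rfl⟩
    obtain ⟨z, hz, h⟩ := hlim σ hσ
    rw [or_self] at h
    subst h
    exact ⟨fun _ => hz, fun _ => hz⟩
  -- The limit of the full path is already `a` or `b`, so a single coordinate separating them
  -- decides which one occurs.
  · obtain ⟨φ, hφ⟩ := not_forall.mp fun h => hab (hsep _ _ h)
    refine ⟨s φ, ⟨(hs φ).1, fun σ hσ => ?_⟩, fun h i => h φ i⟩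
    obtain ⟨z, hz, h⟩ := hlim σ hσ
    have h1 := ((ev φ).continuous.tendsto z).comp hz
    refine ⟨fun hle => ?_, fun hlt => ?_⟩
    · have h2 := tendsto_nhds_unique h1 (((hs φ).2 σ hσ).1 hle)
      rcases h with rfl | rfl
      · exact hz
      · exact absurd h2.symm hφ
    · have h2 := tendsto_nhds_unique h1 (((hs φ).2 σ hσ).2 hlt)
      rcases h with rfl | rfl
      · exact absurd h2 hφ
      · exact hz

/-- Compactness in the Skorokhod space from compact containment and compactness of an additive
separating family of coordinates. -/
theorem isCompact_cadlagMap_of_coordinates (hT : 0 < T) (hK : IsCompact K)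
    (hadd : ∀ φ ψ, ev (φ + ψ) = ev φ + ev ψ) (hsep : ∀ z w, (∀ φ, ev φ z = ev φ w) → z = w)
    {C : Φ → Set (CadlagMap T ℝ)} (hC : ∀ φ, IsCompact (C φ)) :
    IsCompact {x : CadlagMap T F | (∀ t, x t ∈ K) ∧
      ∀ φ, x.map (ev φ) (ev φ).continuous ∈ C φ} := by
  rw [isCompact_iff_ultrafilter_le_nhds]
  intro U hU
  rw [le_principal_iff] at hU
  have hY : ∀ φ, ∃ Y ∈ C φ,
      Tendsto (fun x : CadlagMap T F => x.map (ev φ) (ev φ).continuous) U (𝓝 Y) := fun φ =>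
    (hC φ).ultrafilter_le_nhds
      (U.map fun x : CadlagMap T F => x.map (ev φ) (ev φ).continuous)
      (le_principal_iff.mpr (mem_map.mpr (mem_of_superset hU fun x hx => hx.2 φ)))
  choose Y hYC hY using hY
  -- The factor `ℕ` supplies the positive slack `1 / n → 0` needed for near-optimal time changes;
  -- the ultrafilter `U` alone carries no such sequence.
  let W : Ultrafilter (CadlagMap T F × ℕ) := Ultrafilter.of ((U : Filter (CadlagMap T F)) ×ˢ atTop)
  have hW : (W : Filter (CadlagMap T F × ℕ)) ≤ (U : Filter (CadlagMap T F)) ×ˢ atTop :=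
    Ultrafilter.of_le _
  have hfst : Tendsto Prod.fst (W : Filter (CadlagMap T F × ℕ)) U := tendsto_fst.mono_left hW
  have hsnd : Tendsto Prod.snd (W : Filter (CadlagMap T F × ℕ)) atTop := tendsto_snd.mono_left hW
  have hWK : ∀ᶠ i in (W : Filter (CadlagMap T F × ℕ)), ∀ t, i.1 t ∈ K :=
    hfst.eventually (mem_of_superset hU fun x hx => hx.1)
  have hΛ := fun φ => exists_timeChange_of_tendsto ((hY φ).comp hfst) (normSeminorm ℝ ℝ)
    continuous_norm (N := fun i => (i.2 : ℝ≥0∞)⁻¹) (fun i => by simp)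
    (ENNReal.tendsto_inv_nat_nhds_zero.comp hsnd)
  choose Λ hΛ hΛX using hΛ
  have hX : ∀ φ (σ : CadlagMap T F × ℕ → Icc (0 : ℝ) T),
      Tendsto (fun i => ev φ (i.1 (σ i)) - Y φ (Λ φ i (σ i))) W (𝓝 0) := fun φ σ =>
    tendsto_zero_iff_norm_tendsto_zero.mpr (hΛX φ σ)
  have hg : ∀ r : Icc (0 : ℝ) T, ∃ g ∈ K,
      Tendsto (fun i : CadlagMap T F × ℕ => i.1 r) W (𝓝 g) := fun r =>
    hK.ultrafilter_le_nhds (W.map fun i : CadlagMap T F × ℕ => i.1 r)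
      (le_principal_iff.mpr (hWK.mono fun i hi => hi r))
  choose g hgK hg using hg
  have hYg : ∀ φ r, Tendsto (fun i => Y φ (Λ φ i r)) W (𝓝 (ev φ (g r))) := fun φ r => by
    have := (((ev φ).continuous.tendsto _).comp (hg r)).sub (hX φ fun _ => r)
    simpa using this
  -- The coordinate limits `Y φ t` must be realised by one vector of `K`. Pointwise limits `g r` see
  -- the time-shifted values `Y φ (Λ φ i r)`, so `g t` itself may be wrong at a jump; the right
  -- limit of `g` at `t` is taken instead. At `T`, which time changes fix, `g t` works.
  have hy : ∀ t, ∃ z ∈ K, ∀ φ, ev φ z = Y φ t := by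
    intro t
    rcases t.2.2.eq_or_lt with h | h
    · refine ⟨g t, hgK t, fun φ => tendsto_nhds_unique (hYg φ t) ?_⟩
      have ht : t = ⟨T, right_mem_Icc.mpr hT.le⟩ := Subtype.ext h
      rw [ht]
      simp only [timeChange_last hT.le]
      exact tendsto_const_nhds
    · have : (𝓝[>] t).NeBot := nhdsGT_neBot_of_exists_gt ⟨⟨T, right_mem_Icc.mpr hT.le⟩, h⟩
      obtain ⟨z, hzK, -, hz⟩ := exists_tendsto_of_coordinates hK hsep (l := 𝓝[>] t) (f := g)
        (Eventually.of_forall hgK) (c := fun φ => Y φ t) fun φ => by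
          refine Metric.tendsto_nhds.mpr fun ε hε => ?_
          -- For fixed `r > t` near `t`, the times `Λ φ i r` tend to `r` and hence enter the region
          -- where `Y φ` is close to `Y φ t`; the estimate passes to the limit `ev φ (g r)`.
          have h1 : ∀ᶠ u in 𝓝[>] t, dist (Y φ u) (Y φ t) ≤ ε / 2 :=
            ((Y φ).rightContinuous t).eventually (Metric.closedBall_mem_nhds _ (half_pos hε))
          filter_upwards [eventually_eventually_nhdsWithin.mpr h1, self_mem_nhdsWithin] with r hr hrt
          rw [isOpen_Ioi.nhdsWithin_eq hrt] at hr
          have h2 := (tendsto_timeChange_apply (hΛ φ) (tendsto_const_nhds (x := r))).eventually hr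
          have h3 := le_of_tendsto ((hYg φ r).dist tendsto_const_nhds) h2
          linarith
      exact ⟨z, hzK, hz⟩
  choose y hyK hyY using hy
  let y' : CadlagMap T F := CadlagMap.ofCoordinates hK hsep y hyK Y fun φ t => hyY t φ
  have hlim : Tendsto (fun i : CadlagMap T F × ℕ => i.1) W (𝓝 y') := by
    refine tendsto_of_isSwitch hT fun t b hb => ?_
    have hs : ∀ φ, IsSwitch (W : Filter (CadlagMap T F × ℕ)) (fun i u => ev φ (i.1 u)) t
        (ev φ (y' t)) (ev φ b) (fun i => (Λ φ i).symm t) := fun φ => by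
      have hb' : Tendsto (Y φ) (𝓝[<] t) (𝓝 (ev φ b)) := by
        have := ((ev φ).continuous.tendsto b).comp hb
        exact this.congr fun u => hyY u φ
      have := isSwitch_of_timeChange (X := fun i : CadlagMap T F × ℕ =>
        i.1.map (ev φ) (ev φ).continuous) (hΛ φ) (hX φ) t hb'
      rwa [← hyY t φ] at this
    obtain ⟨s, hs1, hs2⟩ := exists_isSwitch_of_coordinates hK hadd hsep hWK hs
    exact ⟨s, hs1, fun h => hs2 fun φ i => h _⟩
  refine ⟨y', ⟨hyK, fun φ => ?_⟩, ?_⟩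
  · have : y'.map (ev φ) (ev φ).continuous = Y φ := CadlagMap.ext fun t => hyY t φ
    rw [this]
    exact hYC φ
  -- One ultrafilter finer than another equals it, so the auxiliary index can be projected away.
  · have : W.map Prod.fst = U := Ultrafilter.coe_le_coe.mp hfst
    rw [← this]
    exact hlim

end Coordinates

/-! ### Boundedness of càdlàg maps and of compact sets of them. -/

theorem CadlagMap.exists_norm_le {T : ℝ} {G : Type*} [NormedAddCommGroup G]
    (y : CadlagMap T G) : ∃ M : ℝ, ∀ t, ‖y t‖ ≤ M := by
  by_contra! h
  choose u hu using fun n : ℕ => h n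
  let U : Ultrafilter ℕ := hyperfilter ℕ
  have hU : Tendsto (fun n => ‖y (u n)‖) U atTop :=
    (tendsto_atTop_mono (fun n => (hu n).le) tendsto_natCast_atTop_atTop).mono_left
      Nat.hyperfilter_le_atTop
  obtain ⟨t, ht⟩ : ∃ t, Tendsto u U (𝓝 t) := by
    obtain ⟨t, -, ht⟩ := isCompact_univ.ultrafilter_le_nhds (U.map u) (by simp)
    exact ⟨t, ht⟩
  obtain ⟨b, hb⟩ := y.leftLimits t
  -- The ultrafilter approaches `t` either from `t` onwards or strictly from the left; in both cases
  -- `y (u n)` has a limit, contradicting unboundedness.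
  rcases U.em fun n => t ≤ u n with h1 | h1
  · exact not_tendsto_nhds_of_tendsto_atTop hU _ (y.tendsto_of_le ht h1).norm
  · have : Tendsto (fun n => y (u n)) U (𝓝 b) :=
      hb.comp (tendsto_nhdsWithin_iff.mpr ⟨ht, h1.mono fun n hn => not_le.mp hn⟩)
    exact not_tendsto_nhds_of_tendsto_atTop hU _ this.norm

/-- Compact subsets of the Skorokhod space are uniformly bounded. -/
theorem exists_norm_le_of_isCompact {T : ℝ} {F : Type*} [NormedAddCommGroup F] [NormedSpace ℝ F]
    {C : Set (CadlagMap T F)} (hC : IsCompact C) : ∃ M : ℝ, ∀ x ∈ C, ∀ t, ‖x t‖ ≤ M := by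
  by_contra! h
  choose x hxC u hu using fun n : ℕ => h n
  let U : Ultrafilter ℕ := hyperfilter ℕ
  have hU : (U : Filter ℕ) ≤ atTop := Nat.hyperfilter_le_atTop
  obtain ⟨y, -, hy⟩ := hC.ultrafilter_le_nhds (U.map x)
    (le_principal_iff.mpr (Eventually.of_forall (f := (U : Filter ℕ)) hxC))
  obtain ⟨Λ, -, hΛ⟩ := exists_timeChange_of_tendsto (show Tendsto x U (𝓝 y) from hy)
    (normSeminorm ℝ F) continuous_norm (N := fun n => (n : ℝ≥0∞)⁻¹) (fun n => by simp)
    (ENNReal.tendsto_inv_nat_nhds_zero.mono_left hU)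
  obtain ⟨M, hM⟩ := y.exists_norm_le
  have h1 : ∀ᶠ n in (U : Filter ℕ), ‖x n (u n) - y (Λ n (u n))‖ ≤ 1 :=
    (hΛ u).eventually (ge_mem_nhds one_pos)
  have h2 : ∀ᶠ n : ℕ in (U : Filter ℕ), M + 1 ≤ n :=
    (tendsto_natCast_atTop_atTop.mono_left hU).eventually_ge_atTop _
  obtain ⟨n, h1, h2⟩ := (h1.and h2).exists
  have h3 := norm_le_norm_add_norm_sub' (x n (u n)) (y (Λ n (u n)))
  linarith [hu n, hM (Λ n (u n))]

/-! ### Hilbert–Schmidt operators and compact sets of functionals. -/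

section Operators

/-- The operator is the norm limit of its finite-rank truncations `∑ ⟨b i, ·⟩ S (b i)`; by
Cauchy–Schwarz and Bessel, the norm of a finite partial sum is at most the square root of the
corresponding sum of `‖S (b i)‖ ^ 2`. -/
theorem IsHilbertSchmidt.isCompactOperator {H K : Type*} [NormedAddCommGroup H]
    [InnerProductSpace ℝ H] [NormedAddCommGroup K] [InnerProductSpace ℝ K] [CompleteSpace K]
    {S : H →L[ℝ] K} (hS : IsHilbertSchmidt S) : IsCompactOperator S := by
  obtain ⟨w, b, hb⟩ := hS
  let u : w → H →L[ℝ] K := fun i => (innerSL ℝ (b i)).smulRight (S (b i))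
  have hbound : ∀ t : Finset w, ‖∑ i ∈ t, u i‖ ≤ √(∑ i ∈ t, ‖S (b i)‖ ^ 2) := by
    intro t
    refine ContinuousLinearMap.opNorm_le_bound _ (Real.sqrt_nonneg _) fun x => ?_
    have h1 : ‖(∑ i ∈ t, u i) x‖ ≤ ∑ i ∈ t, ‖inner ℝ (b i) x‖ * ‖S (b i)‖ := by
      rw [sum_apply]
      refine (norm_sum_le _ _).trans (le_of_eq ?_)
      exact Finset.sum_congr rfl fun i _ => norm_smul _ _
    have h2 : √(∑ i ∈ t, ‖inner ℝ (b i) x‖ ^ 2) ≤ ‖x‖ := by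
      rw [← Real.sqrt_sq (norm_nonneg x)]
      exact Real.sqrt_le_sqrt (b.orthonormal.sum_inner_products_le x)
    refine h1.trans ((Real.sum_mul_le_sqrt_mul_sqrt _ _ _).trans ?_)
    rw [mul_comm]
    exact mul_le_mul_of_nonneg_left h2 (Real.sqrt_nonneg _)
  have hsum : Summable u := by
    rw [summable_iff_vanishing_norm]
    intro ε hε
    obtain ⟨s, hs⟩ := summable_iff_vanishing_norm.mp hb (ε ^ 2) (by positivity)
    refine ⟨s, fun t ht => (hbound t).trans_lt ?_⟩
    rw [Real.sqrt_lt' hε]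
    exact (le_abs_self _).trans_lt (hs t ht)
  have hSu : HasSum u S := by
    obtain ⟨V, hV⟩ := hsum
    have : V = S := by
      ext x
      have h1 : HasSum (fun i => u i x) (V x) :=
        hV.mapL (ContinuousLinearMap.apply ℝ K x)
      have h2 : HasSum (fun i => u i x) (S x) := by
        refine ((b.hasSum_repr x).mapL S).congr_fun ?_
        intro i
        simp [u, b.repr_apply_apply]
      exact h1.unique h2
    exact this ▸ hV
  refine isCompactOperator_of_tendsto hSu (Eventually.of_forall fun t => ?_)
  refine Submodule.sum_mem (compactOperator (RingHom.id ℝ) H K) (t := t) (f := u) fun i _ => ?_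
  exact (isCompactOperator_of_locallyCompactSpace_rng
    (ContinuousLinearMap.toSpanSingleton ℝ (S (b i)))).comp_clm (innerSL ℝ (b i))

/-- The functionals dominated by a precompact operator form a compact set in the dual norm. -/
theorem isCompact_setOf_abs_le {X E : Type*} [NormedAddCommGroup X] [NormedSpace ℝ X]
    [NormedAddCommGroup E] [NormedSpace ℝ E] {J : X →L[ℝ] E}
    (hJ : TotallyBounded (J '' Metric.closedBall 0 1)) {C : ℝ} (hC : 0 ≤ C) :
    IsCompact {f : StrongDual ℝ X | ∀ v, |f v| ≤ C * ‖J v‖} := by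
  rw [isCompact_iff_ultrafilter_le_nhds]
  intro U hU
  rw [le_principal_iff] at hU
  have hball : ∀ f ∈ {f : StrongDual ℝ X | ∀ v, |f v| ≤ C * ‖J v‖}, ‖f‖ ≤ C * ‖J‖ :=
    fun f hf => f.opNorm_le_bound (by positivity) fun v => (hf v).trans (by
      rw [mul_assoc]
      exact mul_le_mul_of_nonneg_left (J.le_opNorm v) hC)
  -- Banach–Alaoglu gives a weak-* limit; the total boundedness of the image of the unit ball then
  -- turns it into a norm limit.
  obtain ⟨z, -, hz⟩ := (WeakDual.isCompact_closedBall (0 : StrongDual ℝ X)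
    (C * ‖J‖)).ultrafilter_le_nhds (U.map StrongDual.toWeakDual) (le_principal_iff.mpr
      (mem_map.mpr (mem_of_superset hU
        fun f hf => mem_closedBall_zero_iff.mpr (hball f hf))))
  have hzv : ∀ v, Tendsto (fun f : StrongDual ℝ X => f v) U (𝓝 (WeakDual.toStrongDual z v)) :=
    fun v => ((WeakDual.eval_continuous v).tendsto z).comp hz
  set g : StrongDual ℝ X := WeakDual.toStrongDual z
  have hg : ∀ v, |g v| ≤ C * ‖J v‖ := fun v =>
    le_of_tendsto (hzv v).abs (mem_of_superset hU fun f hf => hf v)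
  refine ⟨g, hg, ?_⟩
  change Tendsto (fun f : StrongDual ℝ X => f) U (𝓝 g)
  rw [tendsto_iff_norm_sub_tendsto_zero]
  refine Metric.tendsto_nhds.mpr fun ε hε => ?_
  -- On a finite net, weak-* convergence is uniform. The error on the unit sphere is at most `ε/8 +
  -- ε/4 + ε/8`, and `C + 1` keeps the radius meaningful when `C = 0`.
  obtain ⟨t, htJ, htf, ht⟩ := Metric.finite_approx_of_totallyBounded hJ (ε / (8 * (C + 1)))
    (by positivity)
  have htJ' : ∀ y ∈ t, ∃ v, J v = y := fun y hy => (htJ hy).imp fun v hv => hv.2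
  choose! v hv using htJ'
  have h1 : ∀ᶠ f : StrongDual ℝ X in (U : Filter (StrongDual ℝ X)), ∀ y ∈ t,
      |f (v y) - g (v y)| ≤ ε / 4 := by
    refine (eventually_all_finite htf).mpr fun y _ => ?_
    have := ((hzv (v y)).sub_const (g (v y))).abs
    rw [sub_self, abs_zero] at this
    exact this.eventually (ge_mem_nhds (by positivity))
  filter_upwards [h1, hU] with f hf hfK
  rw [dist_zero_right, norm_norm]
  refine lt_of_le_of_lt (ContinuousLinearMap.opNorm_le_of_unit_norm (C := ε / 2) (by positivity)
    fun x hx => ?_) (half_lt_self hε)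
  have hxb : J x ∈ J '' Metric.closedBall 0 1 := ⟨x, by simp [hx], rfl⟩
  obtain ⟨y, hy, hxy⟩ := mem_iUnion₂.mp (ht hxb)
  rw [Metric.mem_ball, dist_eq_norm, ← hv y hy, ← map_sub] at hxy
  have h2 : C * ‖J (x - v y)‖ ≤ ε / 8 := by
    have h3 : (C + 1) * ‖J (x - v y)‖ ≤ (C + 1) * (ε / (8 * (C + 1))) :=
      mul_le_mul_of_nonneg_left hxy.le (by positivity)
    have h4 : (C + 1) * (ε / (8 * (C + 1))) = ε / 8 := by field_simp
    nlinarith [norm_nonneg (J (x - v y))]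
  have h5 := (hfK (x - v y)).trans h2
  have h6 := (hg (x - v y)).trans h2
  have h7 := hf y hy
  rw [map_sub] at h5 h6
  rw [abs_le] at h5 h6 h7
  change |f x - g x| ≤ ε / 2
  rw [abs_le]
  constructor <;> linarith [h5.1, h5.2, h6.1, h6.2, h7.1, h7.2]

end Operators

/-! ### Barrelled and nuclear spaces. -/

section Nuclear

variable {Φ : Type*} [AddCommGroup Φ] [Module ℝ Φ] [TopologicalSpace Φ]

/-- The pointwise supremum of a pointwise bounded family of functionals on a barrelled space. -/
theorem exists_continuous_seminorm [BarrelledSpace ℝ Φ] {ι : Type*} (f : ι → StrongDual ℝ Φ)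
    (hf : ∀ φ, ∃ M : ℝ, ∀ i, |f i φ| ≤ M) :
    ∃ p : Seminorm ℝ Φ, Continuous p ∧ ∀ i φ, |f i φ| ≤ p φ := by
  let r : ι → Seminorm ℝ Φ := fun i => (normSeminorm ℝ ℝ).comp (f i).toLinearMap
  have hr : BddAbove (range r) := by
    rw [Seminorm.bddAbove_range_iff]
    intro φ
    obtain ⟨M, hM⟩ := hf φ
    exact ⟨M, forall_mem_range.mpr hM⟩
  refine ⟨⨆ i, r i, ?_, fun i φ => le_ciSup hr i φ⟩
  rw [Seminorm.coe_iSup_eq hr]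
  exact Seminorm.continuous_iSup r (fun i => continuous_norm.comp (f i).continuous) hr

theorem continuous_spaceProjection [ContinuousSMul ℝ Φ] (T : ℝ) (φ : Φ) :
    Continuous (spaceProjection T φ : CadlagMap T (StrongDual ℝ Φ) → CadlagMap T ℝ) :=
  continuous_cadlagMap_map
    (E := StrongDual ℝ Φ) (F := ℝ)
    { toFun := fun f => f φ, map_add' := fun _ _ => rfl, map_smul' := fun _ _ => rfl }
    (continuous_eval_const φ)

namespace HilbertSeminorm

/-- The Hilbertian seminorm `φ ↦ ‖L φ‖` of a continuous linear map into an inner product space. -/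
noncomputable def ofMap {H : Type*} [NormedAddCommGroup H] [InnerProductSpace ℝ H]
    (L : Φ →L[ℝ] H) : HilbertSeminorm Φ where
  toSeminorm := (normSeminorm ℝ H).comp L.toLinearMap
  form := (innerₗ H).compl₁₂ L.toLinearMap L.toLinearMap
  form_symm φ ψ := real_inner_comm (L ψ) (L φ)
  sq_eq_form φ := (real_inner_self_eq_norm_sq (L φ)).symm
  continuous_toSeminorm := continuous_norm.comp L.continuous

variable [IsTopologicalAddGroup Φ]

theorem norm_toSpace (q : HilbertSeminorm Φ) (φ : Φ) : ‖q.toSpace φ‖ = q.toSeminorm φ :=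
  UniformSpace.Completion.norm_coe (E := q.Pre) φ

theorem denseRange_toSpace (q : HilbertSeminorm Φ) : DenseRange q.toSpace :=
  UniformSpace.Completion.denseRange_coe (α := q.Pre)

theorem inclusion_toSpace (p q : HilbertSeminorm Φ) (h : p.toSeminorm ≤ q.toSeminorm) (φ : Φ) :
    inclusion p q h (q.toSpace φ) = p.toSpace φ :=
  ContinuousLinearMap.completion_apply_coe (preInclusion p q h) φ

end HilbertSeminorm

variable [IsTopologicalAddGroup Φ]

/-- In a nuclear space, the polar of a neighbourhood of zero is contained in a compact subset of
the Hilbert space dual of some `Φ_q`. -/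
theorem exists_isCompact_dual (hΦ : IsNuclear Φ) (p₀ : Seminorm ℝ Φ) (hp₀ : Continuous p₀) :
    ∃ (q : HilbertSeminorm Φ) (K : Set (StrongDual ℝ q.Space)), IsCompact K ∧
      ∀ f : StrongDual ℝ Φ, (∀ φ, |f φ| ≤ p₀ φ) → ∃ g ∈ K, dualInclusion q g = f := by
  obtain ⟨P, hP, hn⟩ := hΦ
  obtain ⟨s, C, -, hsC⟩ := Seminorm.bound_of_continuous hP p₀ hp₀
  choose r _ hle hHS using fun i : s => hn i.1.1 i.1.2
  -- The direct `ℓ²` sum makes `q ^ 2` the sum of the `(r i) ^ 2`: a single Hilbertian seminorm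
  -- above all the `r i`, whether or not it belongs to `P`.
  let L : Φ →L[ℝ] PiLp 2 fun i : s => (r i).Space :=
    (PiLp.continuousLinearEquiv 2 ℝ fun i : s => (r i).Space).symm.toContinuousLinearMap.comp
      (ContinuousLinearMap.pi fun i => (r i).toSpace)
  let q : HilbertSeminorm Φ := HilbertSeminorm.ofMap L
  have hrq : ∀ i, (r i).toSeminorm ≤ q.toSeminorm := fun i φ => by
    rw [← (r i).norm_toSpace]
    exact PiLp.norm_apply_le (L φ) i
  let J : q.Space →L[ℝ] ((i : s) → (i.1.1 : HilbertSeminorm Φ).Space) :=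
    ContinuousLinearMap.pi fun i =>
      (HilbertSeminorm.inclusion i.1.1 (r i) (hle i)).comp
        (HilbertSeminorm.inclusion (r i) q (hrq i))
  have hJφ : ∀ φ i, J (q.toSpace φ) i = i.1.1.toSpace φ := fun φ i => by
    change HilbertSeminorm.inclusion i.1.1 (r i) (hle i)
      (HilbertSeminorm.inclusion (r i) q (hrq i) (q.toSpace φ)) = _
    rw [HilbertSeminorm.inclusion_toSpace, HilbertSeminorm.inclusion_toSpace]
  -- Each component factors through a Hilbert–Schmidt map, hence is compact, and the image of the
  -- unit ball lies in a finite product of compact sets.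
  have hJ : TotallyBounded (J '' Metric.closedBall 0 1) := by
    have hcomp := fun i => ((hHS i).isCompactOperator.comp_clm
      (HilbertSeminorm.inclusion (r i) q (hrq i))).isCompact_closure_image_closedBall
        (f := ((HilbertSeminorm.inclusion i.1.1 (r i) (hle i)).comp
          (HilbertSeminorm.inclusion (r i) q (hrq i))).toLinearMap) 1
    refine (isCompact_univ_pi hcomp).totallyBounded.subset ?_
    rintro _ ⟨v, hv, rfl⟩ i -
    exact subset_closure ⟨v, hv, rfl⟩
  have hp₀J : ∀ φ, p₀ φ ≤ C * ‖J (q.toSpace φ)‖ := fun φ => by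
    refine (hsC φ).trans (mul_le_mul_of_nonneg_left ?_ C.2)
    refine Seminorm.finset_sup_apply_le (norm_nonneg _) fun i hi => ?_
    rw [← HilbertSeminorm.norm_toSpace, ← hJφ φ ⟨i, hi⟩]
    exact norm_le_pi_norm (J (q.toSpace φ)) ⟨i, hi⟩
  refine ⟨q, _, isCompact_setOf_abs_le hJ C.2, fun f hf => ?_⟩
  -- Domination by `q` lets `f` extend from the dense image of `Φ` to the whole of `Φ_q`; the
  -- sharper bound by `J` then follows by density.
  have hb : ∀ φ, ‖f.toLinearMap φ‖ ≤ C * ‖J‖ * ‖q.toSpace.toLinearMap φ‖ := fun φ => by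
    refine ((hf φ).trans (hp₀J φ)).trans ?_
    rw [mul_assoc]
    exact mul_le_mul_of_nonneg_left (J.le_opNorm _) C.2
  have he : ∀ φ, f.toLinearMap.extendOfNorm q.toSpace.toLinearMap (q.toSpace φ) = f φ :=
    LinearMap.extendOfNorm_eq q.denseRange_toSpace ⟨_, hb⟩
  refine ⟨f.toLinearMap.extendOfNorm q.toSpace.toLinearMap, fun v => ?_, ?_⟩
  · refine q.denseRange_toSpace.induction_on (p := fun v =>
      |f.toLinearMap.extendOfNorm q.toSpace.toLinearMap v| ≤ C * ‖J v‖) v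
      (isClosed_le (by fun_prop) (by fun_prop)) fun φ => ?_
    rw [he]
    exact (hf φ).trans (hp₀J φ)
  · ext φ
    exact he φ

theorem continuous_skorokhodInclusion (T : ℝ) (q : HilbertSeminorm Φ) :
    Continuous (skorokhodInclusion T q) :=
  continuous_cadlagMap_map (dualInclusion q).toLinearMap (dualInclusion q).continuous

variable [ContinuousSMul ℝ Φ]

/-- Uniform boundedness of the coordinates confines all paths of `A` to one compact `K` in some
`Φ'_q`. The lifted paths then lie in the compact set cut out by `K` and the closures of the
projections. -/
theorem exists_isRelativelyCompactIn [BarrelledSpace ℝ Φ] (hΦ : IsNuclear Φ) {T : ℝ} (hT : 0 < T)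
    {A : Set (CadlagMap T (StrongDual ℝ Φ))}
    (hA : ∀ φ : Φ, IsCompact (closure (spaceProjection T φ '' A))) :
    ∃ q : HilbertSeminorm Φ, IsRelativelyCompactIn q A := by
  obtain ⟨p, hp, hAp⟩ := exists_continuous_seminorm (fun i : A × Icc (0 : ℝ) T => i.1.1 i.2)
    fun φ => by
      obtain ⟨M, hM⟩ := exists_norm_le_of_isCompact (hA φ)
      exact ⟨M, fun i => hM _ (subset_closure (mem_image_of_mem _ i.1.2)) i.2⟩
  obtain ⟨q, K, hK, hKf⟩ := exists_isCompact_dual hΦ p hp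
  let ev : Φ → StrongDual ℝ q.Space →L[ℝ] ℝ := fun φ => ContinuousLinearMap.apply ℝ ℝ (q.toSpace φ)
  have hadd : ∀ φ ψ, ev (φ + ψ) = ev φ + ev ψ := fun φ ψ => by
    ext f
    simp [ev]
  have hsep : ∀ z w, (∀ φ, ev φ z = ev φ w) → z = w := fun z w h => by
    refine DFunLike.coe_injective (q.denseRange_toSpace.equalizer z.continuous w.continuous ?_)
    exact funext h
  have hinj : ∀ z w, dualInclusion q z = dualInclusion q w → z = w := fun z w h =>
    hsep z w fun φ => DFunLike.congr_fun h φ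
  refine ⟨q, fun x hx => ?_, ?_⟩
  · choose g hgK hg using fun t => hKf (x t) (hAp (⟨x, hx⟩, t))
    exact ⟨CadlagMap.ofCoordinates hK hsep g hgK (fun φ => spaceProjection T φ x)
      fun φ t => DFunLike.congr_fun (hg t) φ, CadlagMap.ext hg⟩
  · refine (isCompact_cadlagMap_of_coordinates hT hK hadd hsep hA).closure_of_subset fun x hx => ?_
    refine ⟨fun t => ?_, fun φ => subset_closure ⟨_, hx, rfl⟩⟩
    obtain ⟨g, hgK, hg⟩ := hKf _ (hAp (⟨_, hx⟩, t))
    rwa [← hinj _ _ hg]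

end Nuclear

end SkorokhodDual

theorem mainTheorem1 {Φ : Type*} [AddCommGroup Φ] [Module ℝ Φ] [TopologicalSpace Φ]
    [IsTopologicalAddGroup Φ] [ContinuousSMul ℝ Φ] [T2Space Φ]
    (hΦ : SkorokhodDual.IsNuclear Φ) (T : ℝ) (hT : 0 < T)
    (A : Set (SkorokhodDual.CadlagMap T (StrongDual ℝ Φ))) :
    -- (1) implies (2)
    (IsCompact A → ∀ φ : Φ, IsCompact (SkorokhodDual.spaceProjection T φ '' A)) ∧
    -- (3) implies (1)
    ((∃ q : SkorokhodDual.HilbertSeminorm Φ, SkorokhodDual.IsCompactIn q A) → IsCompact A) ∧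
    -- (2) implies (3), for closed sets, if the space is barrelled
    (BarrelledSpace ℝ Φ → IsClosed A →
      (∀ φ : Φ, IsCompact (SkorokhodDual.spaceProjection T φ '' A)) →
      ∃ q : SkorokhodDual.HilbertSeminorm Φ, SkorokhodDual.IsCompactIn q A) ∧
    -- the same three implications, for every set, with relative compactness throughout
    (IsCompact (closure A) →
      ∀ φ : Φ, IsCompact (closure (SkorokhodDual.spaceProjection T φ '' A))) ∧
    ((∃ q : SkorokhodDual.HilbertSeminorm Φ, SkorokhodDual.IsRelativelyCompactIn q A) →
      IsCompact (closure A)) ∧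
    (BarrelledSpace ℝ Φ →
      (∀ φ : Φ, IsCompact (closure (SkorokhodDual.spaceProjection T φ '' A))) →
      ∃ q : SkorokhodDual.HilbertSeminorm Φ, SkorokhodDual.IsRelativelyCompactIn q A) := by
  refine ⟨fun h φ => h.image (SkorokhodDual.continuous_spaceProjection T φ), ?_, ?_, ?_, ?_, ?_⟩
  · rintro ⟨q, hsub, hq⟩
    rw [← image_preimage_eq_of_subset hsub]
    exact hq.image (SkorokhodDual.continuous_skorokhodInclusion T q)
  · intro _ hcl h
    obtain ⟨q, hsub, hq⟩ :=
      SkorokhodDual.exists_isRelativelyCompactIn hΦ hT fun φ => (h φ).closure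
    refine ⟨q, hsub, ?_⟩
    -- Closedness of `A` passes to its preimage in the Skorokhod space over `Φ'_q`, so relative
    -- compactness there is already compactness.
    rwa [(hcl.preimage (SkorokhodDual.continuous_skorokhodInclusion T q)).closure_eq] at hq
  · exact fun h φ => (h.image (SkorokhodDual.continuous_spaceProjection T φ)).closure_of_subset
      (image_mono subset_closure)
  · rintro ⟨q, hsub, hq⟩
    refine (hq.image (SkorokhodDual.continuous_skorokhodInclusion T q)).closure_of_subset ?_
    rw [← image_preimage_eq_of_subset hsub]
    refine image_mono ?_
    rw [image_preimage_eq_of_subset hsub]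
    exact subset_closure
  · intro _ h
    exact SkorokhodDual.exists_isRelativelyCompactIn hΦ hT h
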